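/- Let $G$ be a finite simple graph. An incidence of $G$ is a pair $(v,e)$ where $v$ is a vertex and $e$ is an edge of $G$ incident with $v$. Two distinct incidences $(v,e)$ and $(w,f)$ are adjacent if $v=w$, or $e=f$, or the edge $vw$ equals $e$ or $f$. An incidence $k$-coloring of $G$ is a map from the set of incidences of $G$ to a set of $k$ colors that assigns distinct colors to adjacent incidences, and the incidence chromatic number $\chi_i(G)$ is the smallest $k$ such that $G$ admits an incidence $k$-coloring. For $m,n\ge 3$ let $T_{m,n}=C_m\,\Box\,C_n$ be the toroidal grid, the Cartesian product of the cycles on $m$ and on $n$ vertices. **Theorem.** For all $m,n\ge 3$, $\chi_i(T_{m,n})=5$ if $m\equiv 0\pmod 5$ and $n\equiv 0\pmod 5$, and $\chi_i(T_{m,n})=6$ otherwise. -/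

import Mathlib

namespace SimpleGraph

/-- An incidence of `G`: a pair `(v, e)` of a vertex `v` and an edge `e` of `G` incident to `v`. -/
def Incidence {V : Type*} (G : SimpleGraph V) : Type _ :=
  {p : V × Sym2 V // p.2 ∈ G.edgeSet ∧ p.1 ∈ p.2}

/-- Adjacency of incidences: two distinct incidences `(v, e)` and `(w, f)` are adjacent if
`v = w`, or `e = f`, or the edge `vw` is `e` or `f`. -/
def incidenceGraph {V : Type*} (G : SimpleGraph V) : SimpleGraph G.Incidence where
  Adj i j := i ≠ j ∧
    (i.1.1 = j.1.1 ∨ i.1.2 = j.1.2 ∨ s(i.1.1, j.1.1) = i.1.2 ∨ s(i.1.1, j.1.1) = j.1.2)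
  symm := ⟨by
    rintro i j ⟨hne, h⟩
    refine ⟨hne.symm, ?_⟩
    rw [Sym2.eq_swap]
    rcases h with h | h | h | h
    · exact Or.inl h.symm
    · exact Or.inr (Or.inl h.symm)
    · exact Or.inr (Or.inr (Or.inr h))
    · exact Or.inr (Or.inr (Or.inl h))⟩
  loopless := ⟨fun _ h => h.1 rfl⟩

/-- The incidence chromatic number of `G`: the least `k` for which there is a map from the
incidences of `G` to a set of `k` colors giving distinct colors to adjacent incidences
(`⊤` if there is no such `k`). -/
noncomputable def incidenceChromaticNumber {V : Type*} (G : SimpleGraph V) : ℕ∞ :=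
  G.incidenceGraph.chromaticNumber

/-- The toroidal grid `C_m □ C_n`. -/
abbrev toroidalGrid (m n : ℕ) : SimpleGraph (Fin m × Fin n) :=
  cycleGraph m □ cycleGraph n

end SimpleGraph

/-!
An incidence `(v, vw)` is the dart from `v` to `w`, and a coloring of the darts is proper when the
darts leaving a vertex have distinct colors, none of which is the color of a dart entering it.

Every vertex of the torus has degree four, so at least five colors are needed. If five suffice, then
the four darts leaving a vertex use all colors but one, which is therefore shared by all darts
entering that vertex. The resulting vertex coloring is injective on closed neighborhoods, and around
each vertex the four diagonal cells form one of two mirror-image pinwheels. Hence any five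
consecutive cells of a row have distinct colors, the row has period five, and `5 ∣ m`; likewise for
columns. Conversely `a + 2 * b` modulo `5` is such a vertex coloring.

For six colors, fix a digraph with closed walks of every length at least three. A pattern of dart
colors over the square of this digraph pulls back along two closed walks, of lengths `m` and `n`, to
a coloring of the torus.
-/

section DartColoring

open SimpleGraph

variable {V α : Type*} {G : SimpleGraph V} {f : G.Dart → α}

/-- The incidence `(v, vw)` attached to the dart from `v` to `w`. -/
def dartIncidence (d : G.Dart) : G.Incidence :=
  ⟨(d.fst, d.edge), d.edge_mem, Sym2.mem_mk_left _ _⟩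

theorem dartIncidence_injective : Function.Injective (dartIncidence (G := G)) := by
  intro d d' h
  have hfst : d.fst = d'.fst := congrArg (fun i => i.1.1) h
  have hedge : s(d.fst, d.snd) = s(d'.fst, d'.snd) := congrArg (fun i => i.1.2) h
  rw [hfst] at hedge
  exact Dart.ext _ _ (Prod.ext hfst (Sym2.congr_right.1 hedge))

theorem dartIncidence_surjective : Function.Surjective (dartIncidence (G := G)) := by
  rintro ⟨⟨v, e⟩, he, w, hw : e = s(v, w)⟩
  subst hw
  exact ⟨⟨(v, w), he⟩, rfl⟩

theorem incidenceGraph_adj_dartIncidence {d d' : G.Dart} :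
    G.incidenceGraph.Adj (dartIncidence d) (dartIncidence d') ↔
      d ≠ d' ∧ (d.fst = d'.fst ∨ d.snd = d'.fst ∨ d'.snd = d.fst) := by
  change dartIncidence d ≠ dartIncidence d' ∧
    (d.fst = d'.fst ∨ s(d.fst, d.snd) = s(d'.fst, d'.snd) ∨
      s(d.fst, d'.fst) = s(d.fst, d.snd) ∨ s(d.fst, d'.fst) = s(d'.fst, d'.snd)) ↔ _
  rw [dartIncidence_injective.ne_iff, Sym2.congr_right, Sym2.eq_swap (a := d.fst) (b := d'.fst),
    Sym2.congr_right, Sym2.eq_iff]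
  grind

/-- Incidence colorings transported to darts: darts leaving the same vertex have different colors,
and a dart entering a vertex has a color different from those of all darts leaving it. -/
structure IsDartColoring (f : G.Dart → α) : Prop where
  ne_of_fst_eq_fst : ∀ {d d' : G.Dart}, d ≠ d' → d.fst = d'.fst → f d ≠ f d'
  ne_of_snd_eq_fst : ∀ {d d' : G.Dart}, d.snd = d'.fst → f d ≠ f d'

theorem nonempty_incidenceGraph_coloring_iff :
    Nonempty (G.incidenceGraph.Coloring α) ↔ ∃ f : G.Dart → α, IsDartColoring f := by
  constructor
  · rintro ⟨C⟩
    refine ⟨fun d => C (dartIncidence d), fun hne h => ?_, fun {d d'} h => ?_⟩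
    · exact C.valid (incidenceGraph_adj_dartIncidence.2 ⟨hne, .inl h⟩)
    · have hne : d ≠ d' := by rintro rfl; exact d.snd_ne_fst h
      exact C.valid (incidenceGraph_adj_dartIncidence.2 ⟨hne, .inr (.inl h)⟩)
  · rintro ⟨f, hf⟩
    let e := Equiv.ofBijective _ ⟨dartIncidence_injective (G := G), dartIncidence_surjective⟩
    refine ⟨Coloring.mk (fun i => f (e.symm i)) fun {i j} hij => ?_⟩
    rw [← e.apply_symm_apply i, ← e.apply_symm_apply j] at hij
    obtain ⟨hne, h | h | h⟩ := incidenceGraph_adj_dartIncidence.1 hij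
    · exact hf.ne_of_fst_eq_fst hne h
    · exact hf.ne_of_snd_eq_fst h
    · exact (hf.ne_of_snd_eq_fst h).symm

theorem exists_isDartColoring_of_step {ι : Type*} {step : ι → V → V}
    (hstep : ∀ {v w}, G.Adj v w → ∃ i, step i v = w) {g : V → ι → α}
    (hinj : ∀ v, Function.Injective (g v)) (hne : ∀ v i j, g v i ≠ g (step i v) j) :
    ∃ f : G.Dart → α, IsDartColoring f := by
  choose dir hdir using fun d : G.Dart => hstep d.adj
  refine ⟨fun d => g d.fst (dir d), fun {d d'} hdd' h heq => hdd' ?_, fun {d d'} h => ?_⟩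
  · rw [h] at heq
    refine Dart.ext _ _ (Prod.ext h ?_)
    rw [← hdir d, ← hdir d', hinj _ heq, h]
  · rw [← h, ← hdir d]
    exact hne _ _ _

/-- The set of colors of the darts leaving `v`. -/
def outColors [G.LocallyFinite] [DecidableEq α] (f : G.Dart → α) (v : V) : Finset α :=
  Finset.univ.image fun w => f (G.dartOfNeighborSet v w)

theorem mem_outColors_fst [G.LocallyFinite] [DecidableEq α] (f : G.Dart → α) (d : G.Dart) :
    f d ∈ outColors f d.fst :=
  Finset.mem_image.2 ⟨⟨d.snd, d.adj⟩, Finset.mem_univ _, rfl⟩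

namespace IsDartColoring

theorem card_outColors [G.LocallyFinite] [DecidableEq α] (hf : IsDartColoring f) (v : V) :
    (outColors f v).card = G.degree v := by
  have hinj : Function.Injective fun w => f (G.dartOfNeighborSet v w) := fun w w' h => by
    by_contra hne
    exact hf.ne_of_fst_eq_fst ((G.dartOfNeighborSet_injective v).ne hne) rfl h
  rw [outColors, Finset.card_image_of_injective _ hinj, Finset.card_univ,
    card_neighborSet_eq_degree]

theorem notMem_outColors_snd [G.LocallyFinite] [DecidableEq α] (hf : IsDartColoring f)
    (d : G.Dart) : f d ∉ outColors f d.snd := by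
  intro h
  obtain ⟨w, -, hw⟩ := Finset.mem_image.1 h
  exact hf.ne_of_snd_eq_fst (d' := G.dartOfNeighborSet d.snd w) rfl hw.symm

theorem degree_lt_card [G.LocallyFinite] [Fintype α] (hf : IsDartColoring f) {v w : V}
    (h : G.Adj v w) : G.degree w < Fintype.card α := by
  classical
  rw [← hf.card_outColors]
  exact Finset.card_lt_univ_of_notMem (hf.notMem_outColors_snd ⟨(v, w), h⟩)

theorem exists_injOn_closedNeighborhood [G.LocallyFinite] [Fintype α] (hf : IsDartColoring f)
    {r : ℕ} (hG : G.IsRegularOfDegree r) (hα : Fintype.card α = r + 1) :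
    ∃ c : V → α, ∀ v, Set.InjOn c (insert v (G.neighborSet v)) := by
  classical
  have hmissing : ∀ v, ∃ x, (outColors f v)ᶜ = {x} := fun v => by
    rw [← Finset.card_eq_one, Finset.card_compl, hf.card_outColors, hG v, hα,
      Nat.add_sub_cancel_left]
  choose c hc using hmissing
  have mem_iff : ∀ {x v}, x ∉ outColors f v ↔ x = c v := fun {x v} => by
    rw [← Finset.mem_compl, hc, Finset.mem_singleton]
  have hin : ∀ d : G.Dart, f d = c d.snd := fun d => mem_iff.1 (hf.notMem_outColors_snd d)
  have hadj : ∀ {v w}, G.Adj v w → c v ≠ c w := fun {v w} h heq =>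
    mem_iff.2 ((hin ⟨(v, w), h⟩).trans heq.symm) (mem_outColors_fst f ⟨(v, w), h⟩)
  refine ⟨c, fun v => ?_⟩
  rintro w (rfl | hw) w' (rfl | hw') h
  · rfl
  · exact absurd h (hadj hw')
  · exact absurd h.symm (hadj hw)
  · by_contra hne
    refine hf.ne_of_fst_eq_fst (d := ⟨(v, w), hw⟩) (d' := ⟨(v, w'), hw'⟩) ?_ rfl ?_
    · exact fun hd => hne (congrArg (fun d => d.snd) hd)
    · rwa [hin, hin]

end IsDartColoring

end DartColoring

section Period

variable {A α : Type*} [AddMonoid A] [Fintype α] {a : A} {c : A → α}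

theorem map_add_card_nsmul_of_forall_ne
    (h : ∀ v, ∀ j ∈ Finset.Ico 1 (Fintype.card α), c (v + j • a) ≠ c v) (v : A) :
    c (v + Fintype.card α • a) = c v := by
  have hinj : Function.Injective fun i : Fin (Fintype.card α) => c (v + (i + 1 : ℕ) • a) := by
    refine Function.Injective.of_lt_imp_ne fun i j hij heq => ?_
    refine h (v + (i + 1 : ℕ) • a) (j - i) (Finset.mem_Ico.2 (by omega)) ?_
    rw [add_assoc, ← add_nsmul, show (i + 1 + (j - i) : ℕ) = j + 1 by omega]
    exact heq.symm
  obtain ⟨i, hi⟩ := (Function.Injective.bijective_of_nat_card_le hinj (by simp)).surjective (c v)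
  rcases (Nat.succ_le_of_lt i.2).lt_or_eq with hlt | heq
  · exact absurd hi (h v _ (Finset.mem_Ico.2 ⟨by omega, hlt⟩))
  · rwa [← heq]

theorem card_dvd_of_forall_ne [Nonempty α]
    (h : ∀ v, ∀ j ∈ Finset.Ico 1 (Fintype.card α), c (v + j • a) ≠ c v) {m : ℕ} (hm : m • a = 0) :
    Fintype.card α ∣ m := by
  have hperiod : ∀ q v, c (v + (Fintype.card α * q) • a) = c v := by
    intro q v
    induction q with
    | zero => simp
    | succ q ih => rw [mul_add_one, add_nsmul, ← add_assoc, map_add_card_nsmul_of_forall_ne h, ih]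
  have hmod : c ((m % Fintype.card α) • a) = c 0 := by
    rw [← hperiod (m / Fintype.card α), ← add_nsmul, Nat.mod_add_div, hm]
  by_contra hdvd
  refine h 0 (m % Fintype.card α) (Finset.mem_Ico.2 ⟨?_, Nat.mod_lt _ Fintype.card_pos⟩) ?_
  · exact Nat.pos_of_ne_zero fun h0 => hdvd (Nat.dvd_of_mod_eq_zero h0)
  · rwa [zero_add]

end Period

section Rainbow

variable {A α : Type*} [AddCommGroup A] {a b : A} {c : A → α}

/-- The coloring `c` gives distinct colors to the five cells of every closed neighborhood of the
grid spanned by `a` and `b`. -/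
def IsRainbow (a b : A) (c : A → α) : Prop :=
  ∀ v, ([v, v + a, v + b, v - a, v - b].map c).Nodup

namespace IsRainbow

theorem swap (h : IsRainbow a b c) : IsRainbow b a c := fun v => by
  have := h v
  simp only [List.map_cons, List.map_nil, List.nodup_cons, List.mem_cons,
    List.not_mem_nil] at this ⊢
  grind

theorem neg_left (h : IsRainbow a b c) : IsRainbow (-a) b c := fun v => by
  have := h v
  simp only [List.map_cons, List.map_nil, List.nodup_cons, List.mem_cons, List.not_mem_nil,
    ← sub_eq_add_neg, sub_neg_eq_add] at this ⊢
  grind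

theorem neg_right (h : IsRainbow a b c) : IsRainbow a (-b) c :=
  h.swap.neg_left.swap

theorem add_left_ne (h : IsRainbow a b c) (v : A) : c (v + a) ≠ c v := by
  have := h v
  grind

theorem add_left_ne_sub_left (h : IsRainbow a b c) (v : A) : c (v + a) ≠ c (v - a) := by
  have := h v
  grind

theorem add_left_ne_add_right (h : IsRainbow a b c) (v : A) : c (v + a) ≠ c (v + b) := by
  have := h v
  grind

theorem add_two_left_ne (h : IsRainbow a b c) (v : A) :
    c (v + a + a) ≠ c v ∧ c (v + a + a) ≠ c (v + a) ∧
      c (v + a + a) ≠ c (v + a + b) ∧ c (v + a + a) ≠ c (v + a - b) := by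
  refine ⟨?_, h.add_left_ne _, h.add_left_ne_add_right _, ?_⟩
  · simpa using h.add_left_ne_sub_left (v + a)
  · simpa [← sub_eq_add_neg] using h.neg_right.add_left_ne_add_right (v + a)

variable [Fintype α]

theorem eq_or_of_card_eq_five (h : IsRainbow a b c) (hα : Fintype.card α = 5) (v : A) (x : α) :
    x = c v ∨ x = c (v + a) ∨ x = c (v + b) ∨ x = c (v - a) ∨ x = c (v - b) := by
  classical
  have huniv : ([v, v + a, v + b, v - a, v - b].map c).toFinset = Finset.univ := by
    apply Finset.eq_univ_of_card
    rw [List.toFinset_card_of_nodup (h v), hα]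
    rfl
  have hx := Finset.mem_univ x
  rw [← huniv] at hx
  simpa using hx

theorem corner_eq_or (h : IsRainbow a b c) (hα : Fintype.card α = 5) (v : A) :
    c (v + a + b) = c (v - a) ∨ c (v + a + b) = c (v - b) := by
  have hcenter := h.neg_left.add_left_ne_add_right (v + a)
  have hleft := h.swap.add_left_ne (v + a)
  have hright := h.add_left_ne (v + b)
  rw [add_neg_cancel_right] at hcenter
  rw [add_right_comm] at hright
  have := h.eq_or_of_card_eq_five hα v (c (v + a + b))
  grind

-- Corners at distance two are distinct, so the choices in `corner_eq_or` agree all the way around.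
theorem pinwheel (h : IsRainbow a b c) (hα : Fintype.card α = 5) (v : A) :
    (c (v + a + b) = c (v - b) ∧ c (v + a - b) = c (v - a) ∧
      c (v - a - b) = c (v + b) ∧ c (v - a + b) = c (v + a)) ∨
    (c (v + a + b) = c (v - a) ∧ c (v + a - b) = c (v + b) ∧
      c (v - a - b) = c (v + a) ∧ c (v - a + b) = c (v - b)) := by
  have hNE := h.corner_eq_or hα v
  have hSE := h.neg_right.corner_eq_or hα v
  have hNW := h.neg_left.corner_eq_or hα v
  have hSW := h.neg_left.neg_right.corner_eq_or hα v
  have hE := h.swap.add_left_ne_sub_left (v + a)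
  have hW := h.swap.add_left_ne_sub_left (v - a)
  have hN := h.add_left_ne_sub_left (v + b)
  have hS := h.add_left_ne_sub_left (v - b)
  rw [add_right_comm, add_sub_right_comm] at hN
  rw [sub_add_eq_add_sub, sub_right_comm] at hS
  simp only [← sub_eq_add_neg, sub_neg_eq_add] at hSE hNW hSW
  grind

theorem add_two_left_eq_or (h : IsRainbow a b c) (hα : Fintype.card α = 5) (v : A) :
    (c (v + a + a) = c (v + b) ∧ c (v - a - a) = c (v - b)) ∨
      (c (v + a + a) = c (v - b) ∧ c (v - a - a) = c (v + b)) := by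
  have hE := h.add_two_left_ne v
  have hW := h.neg_left.add_two_left_ne v
  simp only [← sub_eq_add_neg] at hW
  have hE' := h.eq_or_of_card_eq_five hα v (c (v + a + a))
  have hW' := h.eq_or_of_card_eq_five hα v (c (v - a - a))
  rcases h.pinwheel hα v with hp | hp <;> grind

theorem add_nsmul_ne (h : IsRainbow a b c) (hα : Fintype.card α = 5) (v : A) :
    ∀ j ∈ Finset.Ico 1 5, c (v + j • a) ≠ c v := by
  have h₁ := h.add_left_ne v
  have h₂ := (h.add_two_left_ne v).1
  have h₃ : c (v + a + a + a) ≠ c v := by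
    have hu := h (v + a)
    have htwo := h.add_two_left_eq_or hα (v + a)
    rw [add_sub_cancel_right] at hu htwo
    grind
  have h₄ : c (v + a + a + a + a) ≠ c v := by
    have hu := h (v + a + a)
    have htwo := h.add_two_left_eq_or hα (v + a + a)
    rw [add_sub_cancel_right, add_sub_cancel_right] at htwo
    grind
  intro j hj
  obtain ⟨hj₁, hj₅⟩ := Finset.mem_Ico.1 hj
  interval_cases j <;> simpa [succ_nsmul, ← add_assoc]

theorem dvd_of_nsmul_eq_zero (h : IsRainbow a b c) (hα : Fintype.card α = 5) {m : ℕ}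
    (hm : m • a = 0) : 5 ∣ m := by
  have : Nonempty α := ⟨c 0⟩
  exact hα ▸ card_dvd_of_forall_ne (hα ▸ h.add_nsmul_ne hα) hm

end IsRainbow

end Rainbow

section Torus

open SimpleGraph

variable {m n : ℕ}

theorem toroidalGrid_isRegularOfDegree (hm : 3 ≤ m) (hn : 3 ≤ n) :
    (toroidalGrid m n).IsRegularOfDegree 4 := by
  obtain ⟨m, rfl⟩ := Nat.exists_eq_add_of_le' hm
  obtain ⟨n, rfl⟩ := Nat.exists_eq_add_of_le' hn
  intro v
  rw [degree_boxProd, cycleGraph_degree_three_le, cycleGraph_degree_three_le]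

variable [NeZero m] [NeZero n]

theorem cycleGraph_adj_iff_eq_add_or_eq_sub (hm : 2 ≤ m) {u v : Fin m} :
    (cycleGraph m).Adj u v ↔ v = u + 1 ∨ v = u - 1 := by
  obtain ⟨m, rfl⟩ := Nat.exists_eq_add_of_le' hm
  rw [← mem_neighborSet, cycleGraph_neighborSet, Set.mem_insert_iff, Set.mem_singleton_iff,
    or_comm]

theorem fin_one_ne_zero_and_one_ne_neg_one (hm : 3 ≤ m) : (1 : Fin m) ≠ 0 ∧ (1 : Fin m) ≠ -1 := by
  obtain ⟨m, rfl⟩ := Nat.exists_eq_add_of_le' hm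
  simp [Fin.ext_iff, Fin.coe_neg_one]

/-- The four unit steps of the toroidal grid: east, north, west, south. -/
def unitStep (m n : ℕ) [NeZero m] [NeZero n] : Fin 4 → Fin m × Fin n :=
  ![(1, 0), (0, 1), (-1, 0), (0, -1)]

theorem toroidalGrid_adj_iff (hm : 2 ≤ m) (hn : 2 ≤ n) {u v : Fin m × Fin n} :
    (toroidalGrid m n).Adj u v ↔ ∃ i, u + unitStep m n i = v := by
  rw [boxProd_adj, cycleGraph_adj_iff_eq_add_or_eq_sub hm, cycleGraph_adj_iff_eq_add_or_eq_sub hn]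
  have hsteps : (∃ i, u + unitStep m n i = v) ↔
      u + (1, 0) = v ∨ u + (0, 1) = v ∨ u + (-1, 0) = v ∨ u + (0, -1) = v := by
    simp [unitStep, Fin.exists_fin_succ]
  rw [hsteps]
  simp only [Prod.ext_iff, Prod.fst_add, Prod.snd_add, add_zero, ← sub_eq_add_neg]
  grind

theorem IsDartColoring.exists_isRainbow {α : Type*} [Fintype α] {f : (toroidalGrid m n).Dart → α}
    (hf : IsDartColoring f) (hα : Fintype.card α = 5) (hm : 3 ≤ m) (hn : 3 ≤ n) :
    ∃ c : Fin m × Fin n → α, IsRainbow (1, 0) (0, 1) c := by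
  obtain ⟨c, hc⟩ :=
    hf.exists_injOn_closedNeighborhood (toroidalGrid_isRegularOfDegree hm hn) hα
  have hmem : ∀ v, ∀ u ∈ [v, v + (1, 0), v + (0, 1), v - (1, 0), v - (0, 1)],
      u ∈ insert v ((toroidalGrid m n).neighborSet v) := by
    intro v u hu
    simp only [List.mem_cons, List.not_mem_nil, or_false] at hu
    refine hu.imp_right fun hu => (toroidalGrid_adj_iff (by omega) (by omega)).2 ?_
    rcases hu with rfl | rfl | rfl | rfl
    · exact ⟨0, rfl⟩
    · exact ⟨1, rfl⟩
    · exact ⟨2, by simp [unitStep, sub_eq_add_neg]⟩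
    · exact ⟨3, by simp [unitStep, sub_eq_add_neg]⟩
  refine ⟨c, fun v => List.Nodup.map_on (fun u hu w hw => hc v (hmem v u hu) (hmem v w hw)) ?_⟩
  obtain ⟨h₁, h₂⟩ := fin_one_ne_zero_and_one_ne_neg_one hm
  obtain ⟨h₃, h₄⟩ := fin_one_ne_zero_and_one_ne_neg_one hn
  simp [sub_eq_add_neg, h₁, h₂, h₃, h₄]

theorem IsDartColoring.five_dvd {α : Type*} [Fintype α] {f : (toroidalGrid m n).Dart → α}
    (hf : IsDartColoring f) (hα : Fintype.card α = 5) (hm : 3 ≤ m) (hn : 3 ≤ n) :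
    5 ∣ m ∧ 5 ∣ n := by
  obtain ⟨c, hc⟩ := hf.exists_isRainbow hα hm hn
  have hcard : ∀ (k : ℕ) [NeZero k], k • (1 : Fin k) = 0 := fun k _ => by
    simpa using card_nsmul_eq_zero (x := (1 : Fin k))
  exact ⟨hc.dvd_of_nsmul_eq_zero hα (Prod.ext (hcard m) (smul_zero m)),
    hc.swap.dvd_of_nsmul_eq_zero hα (Prod.ext (smul_zero n) (hcard n))⟩

theorem exists_isDartColoring_toroidalGrid_of_pattern (hm : 2 ≤ m) (hn : 2 ≤ n) {A B α : Type*}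
    {R : A → A → Prop} {S : B → B → Prop} {F : A → B → Fin 4 → α}
    (hinj : ∀ a b, Function.Injective (F a b))
    (hR : ∀ a a', R a a' → ∀ b j, F a b 0 ≠ F a' b j ∧ F a' b 2 ≠ F a b j)
    (hS : ∀ b b', S b b' → ∀ a j, F a b 1 ≠ F a b' j ∧ F a b' 3 ≠ F a b j)
    {x : Fin m → A} (hx : ∀ i, R (x i) (x (i + 1)))
    {y : Fin n → B} (hy : ∀ i, S (y i) (y (i + 1))) :
    ∃ f : (toroidalGrid m n).Dart → α, IsDartColoring f := by
  refine exists_isDartColoring_of_step (fun h => (toroidalGrid_adj_iff hm hn).1 h)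
    (g := fun v => F (x v.1) (y v.2)) (fun v => hinj _ _) ?_
  rintro ⟨p, q⟩ i j
  fin_cases i
  · simpa [unitStep] using (hR _ _ (hx p) (y q) j).1
  · simpa [unitStep] using (hS _ _ (hy q) (x p) j).1
  · have hwest := (hR _ _ (hx (p - 1)) (y q) j).2
    rw [sub_add_cancel] at hwest
    simpa [unitStep, sub_eq_add_neg] using hwest
  · have hsouth := (hS _ _ (hy (q - 1)) (x p) j).2
    rw [sub_add_cancel] at hsouth
    simpa [unitStep, sub_eq_add_neg] using hsouth

theorem exists_cyclic_of_closed_walk {A : Type*} {R : A → A → Prop} {w : ℕ → A}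
    (hw : ∀ i < m, R (w i) (w (i + 1))) (hclosed : w m = w 0) :
    ∃ x : Fin m → A, ∀ i, R (x i) (x (i + 1)) := by
  refine ⟨fun i => w i, fun i => ?_⟩
  have hnext : w (i + 1 : Fin m).val = w (i + 1) := by
    rw [Fin.val_add, Fin.val_one', Nat.add_mod_mod]
    rcases (Nat.succ_le_of_lt i.2).lt_or_eq with h | h
    · rw [Nat.mod_eq_of_lt h]
    · rw [← Nat.succ_eq_add_one, h, Nat.mod_self, hclosed]
  change R (w i) (w (i + 1 : Fin m).val)
  rw [hnext]
  exact hw i i.2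

theorem exists_isDartColoring_toroidalGrid_fin_five (hm : 5 ∣ m) (hn : 5 ∣ n) :
    ∃ f : (toroidalGrid m n).Dart → Fin 5, IsDartColoring f := by
  have hwalk : ∀ k : ℕ, ∀ [NeZero k], 5 ∣ k → ∃ x : Fin k → Fin 5, ∀ i, x (i + 1) = x i + 1 :=
    fun k _ hk => exists_cyclic_of_closed_walk (R := fun a b : Fin 5 => b = a + 1)
      (w := Fin.ofNat 5) (fun i _ => by simp [Fin.ext_iff, Fin.val_add])
      (by simp [Fin.ext_iff, Nat.mod_eq_zero_of_dvd hk])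
  obtain ⟨x, hx⟩ := hwalk m hm
  obtain ⟨y, hy⟩ := hwalk n hn
  have hm2 := Nat.le_of_dvd (NeZero.pos m) hm
  have hn2 := Nat.le_of_dvd (NeZero.pos n) hn
  -- Darts into the cell `(a, b)` get the color `a + 2 * b`, which separates all cells at distance
  -- at most two.
  exact exists_isDartColoring_toroidalGrid_of_pattern (by omega) (by omega)
    (R := fun a b : Fin 5 => b = a + 1) (S := fun a b : Fin 5 => b = a + 1)
    (F := fun a b => ![a + 1 + 2 * b, a + 2 * (b + 1), a - 1 + 2 * b, a + 2 * (b - 1)])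
    (by decide) (by decide) (by decide) hx hy

/-- Successors in a digraph formed by the directed triangle `0 → 1 → 2 → 0`, the directed 4-cycle
`0 → 3 → 4 → 5 → 0` and the arc `4 → 1`, which closes the 5-cycle `0 → 3 → 4 → 1 → 2 → 0`. It is
chosen to have closed walks through `0` of every length at least three. -/
def detourSucc : Fin 6 → Finset (Fin 6) :=
  ![{1, 3}, {2}, {0}, {4}, {1, 5}, {0}]

theorem exists_detourSucc_closed_walk : ∀ k : ℕ, ∃ w : ℕ → Fin 6,
    w 0 = 0 ∧ w (k + 3) = 0 ∧ ∀ i < k + 3, w (i + 1) ∈ detourSucc (w i)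
  | 0 => ⟨fun i => [0, 1, 2].getD i 0, rfl, rfl, by decide⟩
  | 1 => ⟨fun i => [0, 3, 4, 5].getD i 0, rfl, rfl, by decide⟩
  | 2 => ⟨fun i => [0, 3, 4, 1, 2].getD i 0, rfl, rfl, by decide⟩
  | k + 3 => by
    obtain ⟨w, hfirst, hlast, hw⟩ := exists_detourSucc_closed_walk k
    refine ⟨fun | 0 => 0 | 1 => 1 | 2 => 2 | i + 3 => w i, rfl, hlast, ?_⟩
    rintro (_ | _ | _ | i) hi
    · exact show (1 : Fin 6) ∈ detourSucc 0 by decide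
    · exact show (2 : Fin 6) ∈ detourSucc 1 by decide
    · change w 0 ∈ detourSucc 2
      rw [hfirst]
      decide
    · exact hw i (by omega)

/-- A six-coloring pattern over the square of the digraph `detourSucc`: the colors of the darts
leaving a cell of type `(a, b)`, listed in the order of `unitStep`. The table was found by a
computer search. -/
def sixColorPattern : Fin 6 → Fin 6 → Fin 4 → Fin 6 :=
  ![![![0, 1, 2, 3], ![4, 2, 3, 5], ![1, 4, 5, 0], ![2, 0, 3, 5], ![3, 1, 2, 4], ![2, 5, 4, 0]],
    ![![3, 5, 4, 2], ![3, 2, 0, 1], ![5, 0, 3, 4], ![3, 1, 4, 0], ![4, 5, 0, 2], ![4, 0, 3, 1]],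
    ![![5, 0, 1, 4], ![1, 4, 5, 2], ![2, 3, 1, 0], ![1, 4, 5, 2], ![5, 0, 1, 3], ![1, 3, 5, 2]],
    ![![1, 3, 4, 2], ![0, 2, 1, 5], ![5, 0, 3, 4], ![4, 5, 1, 0], ![1, 4, 0, 2], ![3, 0, 1, 5]],
    ![![0, 2, 5, 3], ![4, 5, 3, 1], ![1, 4, 2, 0], ![5, 0, 3, 1], ![3, 2, 5, 4], ![5, 1, 4, 0]],
    ![![4, 3, 1, 5], ![1, 5, 0, 2], ![2, 0, 3, 4], ![1, 2, 4, 0], ![0, 4, 1, 5], ![1, 0, 2, 3]]]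

theorem exists_isDartColoring_toroidalGrid_fin_six (hm : 3 ≤ m) (hn : 3 ≤ n) :
    ∃ f : (toroidalGrid m n).Dart → Fin 6, IsDartColoring f := by
  have hwalk : ∀ k : ℕ, ∀ [NeZero k], 3 ≤ k →
      ∃ x : Fin k → Fin 6, ∀ i, x (i + 1) ∈ detourSucc (x i) := by
    intro k _ hk
    obtain ⟨k, rfl⟩ := Nat.exists_eq_add_of_le' hk
    obtain ⟨w, hfirst, hlast, hw⟩ := exists_detourSucc_closed_walk k
    exact exists_cyclic_of_closed_walk (R := fun a b => b ∈ detourSucc a) hw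
      (hlast.trans hfirst.symm)
  obtain ⟨x, hx⟩ := hwalk m hm
  obtain ⟨y, hy⟩ := hwalk n hn
  exact exists_isDartColoring_toroidalGrid_of_pattern (by omega) (by omega)
    (R := fun a b => b ∈ detourSucc a) (S := fun a b => b ∈ detourSucc a)
    (F := sixColorPattern) (by decide) (by decide) (by decide) hx hy

theorem toroidalGrid_colorable_five_iff (hm : 3 ≤ m) (hn : 3 ≤ n) :
    (toroidalGrid m n).incidenceGraph.Colorable 5 ↔ 5 ∣ m ∧ 5 ∣ n := by
  refine nonempty_incidenceGraph_coloring_iff.trans ⟨?_, fun h => ?_⟩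
  · rintro ⟨f, hf⟩
    exact hf.five_dvd (Fintype.card_fin 5) hm hn
  · exact exists_isDartColoring_toroidalGrid_fin_five h.1 h.2

theorem toroidalGrid_colorable_six (hm : 3 ≤ m) (hn : 3 ≤ n) :
    (toroidalGrid m n).incidenceGraph.Colorable 6 :=
  nonempty_incidenceGraph_coloring_iff.2 (exists_isDartColoring_toroidalGrid_fin_six hm hn)

theorem toroidalGrid_not_colorable_four (hm : 3 ≤ m) (hn : 3 ≤ n) :
    ¬ (toroidalGrid m n).incidenceGraph.Colorable 4 := by
  intro h
  obtain ⟨f, hf⟩ := nonempty_incidenceGraph_coloring_iff.1 h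
  have hadj : (toroidalGrid m n).Adj 0 (0 + unitStep m n 0) :=
    (toroidalGrid_adj_iff (by omega) (by omega)).2 ⟨0, rfl⟩
  have hlt := hf.degree_lt_card hadj
  rw [toroidalGrid_isRegularOfDegree hm hn, Fintype.card_fin] at hlt
  exact hlt.false

end Torus

theorem theorem1 (m n : ℕ) (hm : 3 ≤ m) (hn : 3 ≤ n) :
    ((m ≡ 0 [MOD 5] ∧ n ≡ 0 [MOD 5]) →
      (SimpleGraph.toroidalGrid m n).incidenceChromaticNumber = 5) ∧
    (¬ (m ≡ 0 [MOD 5] ∧ n ≡ 0 [MOD 5]) →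
      (SimpleGraph.toroidalGrid m n).incidenceChromaticNumber = 6) := by
  have : NeZero m := ⟨by omega⟩
  have : NeZero n := ⟨by omega⟩
  rw [Nat.modEq_zero_iff_dvd, Nat.modEq_zero_iff_dvd, ← toroidalGrid_colorable_five_iff hm hn]
  constructor
  · intro h5
    exact (SimpleGraph.chromaticNumber_eq_iff_colorable_not_colorable (n := 4)).2
      ⟨h5, toroidalGrid_not_colorable_four hm hn⟩
  · intro h5
    exact (SimpleGraph.chromaticNumber_eq_iff_colorable_not_colorable (n := 5)).2
      ⟨toroidalGrid_colorable_six hm hn, h5⟩
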